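/- Call a group $G$ sofic if it is isomorphic to a subgroup of a metric ultraproduct $\prod_{i\in I}(S_{n(i)},d_i)/\mathcal U$ for some set $I$, some ultrafilter $\mathcal U$ on $I$ and some $n\colon I\to\mathbb N$, where $S_n$ is the symmetric group of degree $n$ and $d_i$ is the normalized Hamming metric on $S_{n(i)}$, the proportion of points at which two permutations differ; here the metric ultraproduct is the quotient of the direct product $\prod_i S_{n(i)}$ by the normal subgroup of all $(x_i)$ with $\lim_{i\to\mathcal U}d_i(x_i,1)=0$. Call a group $G$ $\aleph_0$-existentially closed if every finite system of equations $w=1$ and inequations $w\neq 1$ in finitely many variables, with coefficients in $G$, that has a solution in some group containing $G$ as a subgroup has a solution in $G$. Let $G$ be a countable $\aleph_0$-existentially closed non-sofic group, and let $A\le G$ be a finitely generated subgroup. Then the centralizer $C_G(A)$ is non-sofic. Moreover, if $Z(A)=1$, then $C_G(A)\cong G$. In particular, in this case $C_G(A)$ is a countable $\aleph_0$-existentially closed non-sofic group. -/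

import Mathlib

universe u

/-- The normalized Hamming metric on the symmetric group `S_n`: the proportion of the points of
`{0, …, n - 1}` at which two permutations differ. -/
noncomputable def hammingMetric {n : ℕ} (σ τ : Equiv.Perm (Fin n)) : ℝ :=
  (hammingDist (σ : Fin n → Fin n) (τ : Fin n → Fin n) : ℝ) / n

theorem hammingMetric_self {n : ℕ} (σ : Equiv.Perm (Fin n)) : hammingMetric σ σ = 0 := by
  simp [hammingMetric]

theorem hammingMetric_nonneg {n : ℕ} (σ τ : Equiv.Perm (Fin n)) : 0 ≤ hammingMetric σ τ := by
  unfold hammingMetric; positivity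

theorem hammingMetric_comm {n : ℕ} (σ τ : Equiv.Perm (Fin n)) :
    hammingMetric σ τ = hammingMetric τ σ := by
  simp [hammingMetric, hammingDist_comm]

theorem hammingMetric_triangle {n : ℕ} (σ τ ρ : Equiv.Perm (Fin n)) :
    hammingMetric σ ρ ≤ hammingMetric σ τ + hammingMetric τ ρ := by
  unfold hammingMetric
  rw [← add_div]
  gcongr
  exact_mod_cast hammingDist_triangle _ _ _

theorem hammingMetric_mul_left {n : ℕ} (ρ σ τ : Equiv.Perm (Fin n)) :
    hammingMetric (ρ * σ) (ρ * τ) = hammingMetric σ τ := by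
  simp [hammingMetric, hammingDist]

theorem hammingMetric_mul_right {n : ℕ} (ρ σ τ : Equiv.Perm (Fin n)) :
    hammingMetric (σ * ρ) (τ * ρ) = hammingMetric σ τ := by
  have h : hammingDist (⇑(σ * ρ)) (⇑(τ * ρ)) = hammingDist (⇑σ) (⇑τ) :=
    Finset.card_bij (fun i _ => ρ i)
      (fun i hi => Finset.mem_filter.2 ⟨Finset.mem_univ _, (Finset.mem_filter.1 hi).2⟩)
      (fun i _ j _ hij => ρ.injective hij)
      (fun j hj => ⟨ρ.symm j, Finset.mem_filter.2 ⟨Finset.mem_univ _, by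
        simpa using (Finset.mem_filter.1 hj).2⟩, by simp⟩)
  simp only [hammingMetric, h]

/-- The subgroup of the product `∏ i, S_{n i}` of the families which are infinitesimally close to
the identity along the ultrafilter `U` : `lim_{i → U} d(x i, 1) = 0`. -/
def hammingInfinitesimal {ι : Type u} (U : Ultrafilter ι) (n : ι → ℕ) :
    Subgroup (∀ i, Equiv.Perm (Fin (n i))) where
  carrier := {x | Filter.Tendsto (fun i => hammingMetric (x i) 1) (U : Filter ι) (nhds 0)}
  one_mem' := by simp [hammingMetric_self]
  mul_mem' {x y} hx hy := by
    refine squeeze_zero (fun i => hammingMetric_nonneg _ _) (fun i => ?_) (by simpa using hy.add hx)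
    have h1 := hammingMetric_triangle (x i * y i) (x i * 1) 1
    rw [hammingMetric_mul_left, mul_one] at h1
    exact h1
  inv_mem' {x} hx := by
    refine hx.congr fun i => ?_
    have h1 := hammingMetric_mul_left (x i)⁻¹ (x i) 1
    rw [inv_mul_cancel, mul_one, hammingMetric_comm] at h1
    exact h1.symm

instance hammingInfinitesimal_normal {ι : Type u} (U : Ultrafilter ι) (n : ι → ℕ) :
    (hammingInfinitesimal U n).Normal where
  conj_mem x hx g := by
    refine Filter.Tendsto.congr (fun i => ?_) hx
    have h1 := hammingMetric_mul_right (g i)⁻¹ (g i * x i) (g i * 1)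
    rw [hammingMetric_mul_left, mul_one, mul_inv_cancel] at h1
    exact h1.symm

/-- The metric ultraproduct along `U` of the finite symmetric groups `S_{n i}` with the normalized
Hamming metrics. -/
abbrev HammingUltraproduct {ι : Type u} (U : Ultrafilter ι) (n : ι → ℕ) : Type u :=
  (∀ i, Equiv.Perm (Fin (n i))) ⧸ hammingInfinitesimal U n

/-- A group is sofic if it is isomorphic to a subgroup of a metric ultraproduct of finite symmetric
groups with the normalized Hamming metrics. -/
def IsSofic (G : Type u) [Group G] : Prop :=
  ∃ (ι : Type u) (U : Ultrafilter ι) (n : ι → ℕ) (φ : G →* HammingUltraproduct U n),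
    Function.Injective φ

/-- The value in `H` of a word `w` in `m` variables with coefficients in `G`, when the coefficients
are read in `H` through `f` and the variables take the values `v`. -/
def evalWord {G H : Type u} [Group G] [Group H] {m : ℕ} (f : G →* H) (v : Fin m → H)
    (w : Monoid.Coprod G (FreeGroup (Fin m))) : H :=
  Monoid.Coprod.lift f (FreeGroup.lift v) w

/-- The family `v` in `H` solves the system of equations `w = 1`, `w ∈ E`, and inequations
`w ≠ 1`, `w ∈ I`, with coefficients in `G` read in `H` through `f`. -/
def IsSolution {G H : Type u} [Group G] [Group H] {m : ℕ} (f : G →* H)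
    (E I : Set (Monoid.Coprod G (FreeGroup (Fin m)))) (v : Fin m → H) : Prop :=
  (∀ w ∈ E, evalWord f v w = 1) ∧ ∀ w ∈ I, evalWord f v w ≠ 1

/-- `G` is `ℵ₀`-existentially closed: every system of fewer than `ℵ₀` (that is, finitely many)
equations and inequations with coefficients in `G` which has a solution in some overgroup of `G`
has a solution in `G`. (Such a group is necessarily infinite, as for each `k` the existence of `k`
distinct elements is expressed by finitely many inequations.) -/
def IsAlephZeroExistentiallyClosed (G : Type u) [Group G] : Prop :=
  ∀ (m : ℕ) (E I : Set (Monoid.Coprod G (FreeGroup (Fin m)))), E.Finite → I.Finite →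
    (∃ (H : Type u) (_ : Group H) (f : G →* H), Function.Injective f ∧
      ∃ v : Fin m → H, IsSolution f E I v) →
    ∃ v : Fin m → G, IsSolution (MonoidHom.id G) E I v

open Function
open scoped commutatorElement

/-! Soficity passes to subgroups, so it is enough to embed `G` in the centralizer of `A`. The
embedding is a pointwise limit of inner automorphisms, built along an enumeration of `G`: at each
stage a finite set has been conjugated onto a set `D` that commutes with `A` and generates with it a
direct product. To take in a further `g`, one conjugates by some `z` that fixes `D` and moves `g`
into place (`exists_commute_isDirectComplement`). Such a `z` exists in an overgroup, by an HNN
extension of `G × G`, hence in `G`.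

The obstacle is that trivial intersection with `A` is not a finite system of inequations. A mitosis
expresses it by finitely many equations: its `u` centralizes no nontrivial element of `A`. If `Z(A)
= 1`, the intersection condition is automatic, so every element of the centralizer can also be put
in the image, back and forth. -/

theorem IsSofic.of_injective {G H : Type u} [Group G] [Group H] (hH : IsSofic H) (f : G →* H)
    (hf : Injective f) : IsSofic G := by
  obtain ⟨ι, U, n, φ, hφ⟩ := hH
  exact ⟨ι, U, n, φ.comp f, hφ.comp hf⟩

/-! ### Words under homomorphisms, and transfer along isomorphisms -/

theorem evalWord_map {G G' H : Type u} [Group G] [Group G'] [Group H] {m : ℕ} (e : G →* G')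
    (f : G' →* H) (v : Fin m → H) (w : Monoid.Coprod G (FreeGroup (Fin m))) :
    evalWord f v (Monoid.Coprod.map e (MonoidHom.id _) w) = evalWord (f.comp e) v w := by
  have : (Monoid.Coprod.lift f (FreeGroup.lift v)).comp
      (Monoid.Coprod.map e (MonoidHom.id _)) =
      Monoid.Coprod.lift (f.comp e) (FreeGroup.lift v) :=
    Monoid.Coprod.hom_ext (by ext; simp) (by ext; simp)
  exact DFunLike.congr_fun this w

theorem map_evalWord {G H K : Type u} [Group G] [Group H] [Group K] {m : ℕ} (f : G →* H)
    (h : H →* K) (v : Fin m → H) (w : Monoid.Coprod G (FreeGroup (Fin m))) :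
    h (evalWord f v w) = evalWord (h.comp f) (h ∘ v) w := by
  have : h.comp (Monoid.Coprod.lift f (FreeGroup.lift v)) =
      Monoid.Coprod.lift (h.comp f) (FreeGroup.lift (h ∘ v)) :=
    Monoid.Coprod.hom_ext (by ext; simp) (by ext; simp)
  exact DFunLike.congr_fun this w

theorem IsAlephZeroExistentiallyClosed.of_mulEquiv {G G' : Type u} [Group G] [Group G']
    (hG : IsAlephZeroExistentiallyClosed G) (e : G ≃* G') :
    IsAlephZeroExistentiallyClosed G' := by
  rintro m E I hE hI ⟨H, _, f, hf, v, hvE, hvI⟩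
  let τ : Monoid.Coprod G' (FreeGroup (Fin m)) →* Monoid.Coprod G (FreeGroup (Fin m)) :=
    Monoid.Coprod.map e.symm.toMonoidHom (MonoidHom.id _)
  have hτ : ∀ {K : Type u} [Group K] (k : G' →* K) (u : Fin m → K) w,
      evalWord (k.comp e.toMonoidHom) u (τ w) = evalWord k u w := by
    intro K _ k u w
    rw [evalWord_map]
    congr 1
    ext x
    simp
  obtain ⟨v', hv'E, hv'I⟩ := hG m (τ '' E) (τ '' I) (hE.image _) (hI.image _)
    ⟨H, _, f.comp e.toMonoidHom, hf.comp e.injective, v, by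
      rintro _ ⟨w, hw, rfl⟩
      rw [hτ]
      exact hvE w hw, by
      rintro _ ⟨w, hw, rfl⟩
      rw [hτ]
      exact hvI w hw⟩
  have key : ∀ w, evalWord (MonoidHom.id G') (e ∘ v') w =
      e (evalWord (MonoidHom.id G) v' (τ w)) := by
    intro w
    rw [← hτ]
    exact (map_evalWord (MonoidHom.id G) e.toMonoidHom v' (τ w)).symm
  refine ⟨e ∘ v', fun w hw => ?_, fun w hw => ?_⟩
  · rw [key, hv'E _ ⟨w, hw, rfl⟩, map_one]
  · rw [key, Ne, EmbeddingLike.map_eq_one_iff]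
    exact hv'I _ ⟨w, hw, rfl⟩

theorem IsAlephZeroExistentiallyClosed.exists_evalWord_eq_one {G H : Type u} [Group G] [Group H]
    (hEC : IsAlephZeroExistentiallyClosed G) {m : ℕ}
    {E : Set (Monoid.Coprod G (FreeGroup (Fin m)))} (hE : E.Finite) (f : G →* H)
    (hf : Injective f) (v : Fin m → H) (hv : ∀ w ∈ E, evalWord f v w = 1) :
    ∃ v : Fin m → G, ∀ w ∈ E, evalWord (MonoidHom.id G) v w = 1 := by
  obtain ⟨v', h, -⟩ := hEC m E ∅ hE Set.finite_empty ⟨H, _, f, hf, v, hv, by simp⟩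
  exact ⟨v', h⟩

/-! ### HNN extensions and mitosis -/

/-- Two embeddings of a group in `H` become conjugate in an overgroup of `H`. -/
theorem exists_overgroup_conj {A H : Type u} [Group A] [Group H] (p q : A →* H)
    (hp : Injective p) (hq : Injective q) :
    ∃ (K : Type u) (_ : Group K) (i : H →* K), Injective i ∧
      ∃ t : K, ∀ a, t * i (p a) * t⁻¹ = i (q a) := by
  let φ : p.range ≃* q.range := (p.ofInjective hp).symm.trans (q.ofInjective hq)
  refine ⟨HNNExtension H _ _ φ, inferInstance, HNNExtension.of, HNNExtension.of_injective φ,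
    HNNExtension.t, fun a => ?_⟩
  have h := HNNExtension.t_mul_of (φ := φ) (p.ofInjective hp a)
  rw [mul_inv_eq_iff_eq_mul]
  have hφ : φ (p.ofInjective hp a) = q.ofInjective hq a := by simp [φ]
  rwa [hφ] at h

/-- Elements `s`, `u` such that the conjugate of `T` by `s` commutes with `T`, and conjugation by
`u` sends each `a` in `T` to `a * (s * a * s⁻¹)`. -/
def IsMitosis {G : Type u} [Group G] (T : Set G) (s u : G) : Prop :=
  (∀ a ∈ T, ∀ b ∈ T, Commute a (s * b * s⁻¹)) ∧ ∀ a ∈ T, u * a * u⁻¹ = a * (s * a * s⁻¹)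

/-- Both relations extend from `T` to its closure, the second because `a` and `s * b * s⁻¹` commute,
which makes `a ↦ a * (s * a * s⁻¹)` multiplicative. If `u` fixes `a`, then `s * a * s⁻¹ = 1`. -/
theorem IsMitosis.eq_one_of_commute {G : Type u} [Group G] {T : Set G} {s u : G}
    (h : IsMitosis T s u) {a : G} (ha : a ∈ Subgroup.closure T) (hua : Commute u a) : a = 1 := by
  have h1 : ∀ b ∈ T, ∀ a ∈ Subgroup.closure T, Commute (s * b * s⁻¹) a := by
    intro b hb a ha
    induction ha using Subgroup.closure_induction with
    | mem x hx => exact (h.1 x hx b hb).symm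
    | one => exact Commute.one_right _
    | mul x y _ _ hx hy => exact hx.mul_right hy
    | inv x _ hx => exact hx.inv_right
  have h2 : ∀ a ∈ Subgroup.closure T, ∀ b ∈ Subgroup.closure T, Commute a (s * b * s⁻¹) := by
    intro a ha b hb
    induction hb using Subgroup.closure_induction with
    | mem x hx => exact (h1 x hx a ha).symm
    | one => simp
    | mul x y _ _ hx hy => simpa [mul_assoc] using hx.mul_right hy
    | inv x _ hx => simpa [mul_assoc] using hx.inv_right
  have h3 : ∀ a ∈ Subgroup.closure T, u * a * u⁻¹ = a * (s * a * s⁻¹) := by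
    intro a ha
    induction ha using Subgroup.closure_induction with
    | mem x hx => exact h.2 x hx
    | one => simp
    | mul x y hx hy ihx ihy =>
      have e : u * (x * y) * u⁻¹ = (u * x * u⁻¹) * (u * y * u⁻¹) := by group
      have c := (h2 y hy x hx).eq
      rw [e, ihx, ihy]
      calc x * (s * x * s⁻¹) * (y * (s * y * s⁻¹))
          = x * ((s * x * s⁻¹) * y) * (s * y * s⁻¹) := by group
        _ = x * y * (s * (x * y) * s⁻¹) := by rw [← c]; group
    | inv x hx ihx =>
      have c := (h2 x hx x hx).eq
      have e : u * x⁻¹ * u⁻¹ = (u * x * u⁻¹)⁻¹ := by group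
      rw [e, ihx, c]
      group
  have h4 := h3 a ha
  rw [hua.eq, mul_inv_cancel_right, eq_comm, mul_eq_left] at h4
  simpa using h4

theorem IsAlephZeroExistentiallyClosed.exists_isMitosis {G : Type u} [Group G]
    (hEC : IsAlephZeroExistentiallyClosed G) {T : Set G} (hT : T.Finite) :
    ∃ s u, IsMitosis T s u := by
  let A := Subgroup.closure T
  -- With `G` as first factor of `G × G`, `s` carries `(a, 1)` to `(1, a)`, and `u` below carries
  -- `(a, 1)` to `(a, a)`, the product of the two.
  obtain ⟨K, _, i, hi, s, hs⟩ := exists_overgroup_conj (H := G × G)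
    ((MonoidHom.inl G G).comp A.subtype) ((MonoidHom.inr G G).comp A.subtype)
    (fun a b h => by simpa using h) (fun a b h => by simpa using h)
  obtain ⟨L, _, j, hj, u, hu⟩ := exists_overgroup_conj
    (i.comp ((MonoidHom.inl G G).comp A.subtype)) (i.comp (A.subtype.prod A.subtype))
    (hi.comp fun a b h => by simpa using h) (hi.comp fun a b h => by simpa using h)
  let C : G →* Monoid.Coprod G (FreeGroup (Fin 2)) := Monoid.Coprod.inl
  let X : Fin 2 → Monoid.Coprod G (FreeGroup (Fin 2)) := fun k =>
    Monoid.Coprod.inr (FreeGroup.of k)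
  let E : Set (Monoid.Coprod G (FreeGroup (Fin 2))) :=
    Set.image2 (fun a b => ⁅C a, X 0 * C b * (X 0)⁻¹⁆) T T ∪
    (fun a => X 1 * C a * (X 1)⁻¹ * (C a * (X 0 * C a * (X 0)⁻¹))⁻¹) '' T
  have hE : E.Finite := (hT.image2 _ hT).union (hT.image _)
  have hsT : ∀ a ∈ T, s * i (a, 1) * s⁻¹ = i (1, a) := fun a ha =>
    hs ⟨a, Subgroup.subset_closure ha⟩
  have hjs : ∀ a ∈ T, j s * j (i (a, 1)) * (j s)⁻¹ = j (i (1, a)) := fun a ha => by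
    rw [← hsT a ha]; simp
  have hju : ∀ a ∈ T, u * j (i (a, 1)) * u⁻¹ = j (i (a, a)) := fun a ha =>
    hu ⟨a, Subgroup.subset_closure ha⟩
  obtain ⟨v, hv⟩ := hEC.exists_evalWord_eq_one hE
    (j.comp (i.comp (MonoidHom.inl G G))) (hj.comp (hi.comp fun a b h => by simpa using h))
    ![j s, u] (by
      rintro w (⟨a, ha, b, hb, rfl⟩ | ⟨a, ha, rfl⟩)
      · simp only [evalWord, C, X, map_commutatorElement, map_mul, map_inv,
          Monoid.Coprod.lift_apply_inl, Monoid.Coprod.lift_apply_inr, FreeGroup.lift_apply_of,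
          Matrix.cons_val_zero, MonoidHom.comp_apply, MonoidHom.inl_apply, hjs b hb]
        rw [commutatorElement_eq_one_iff_commute, Commute, SemiconjBy]
        simp [← map_mul]
      · simp only [evalWord, C, X, map_mul, map_inv,
          Monoid.Coprod.lift_apply_inl, Monoid.Coprod.lift_apply_inr, FreeGroup.lift_apply_of,
          Matrix.cons_val_zero, Matrix.cons_val_one, MonoidHom.comp_apply, MonoidHom.inl_apply,
          hjs a ha, hju a ha]
        rw [mul_inv_eq_one]
        simp [← map_mul])
  refine ⟨v 0, v 1, fun a ha b hb => ?_, fun a ha => ?_⟩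
  · have := hv _ (Or.inl ⟨a, ha, b, hb, rfl⟩)
    simpa [evalWord, C, X, map_commutatorElement, commutatorElement_eq_one_iff_commute] using this
  · have := hv _ (Or.inr ⟨a, ha, rfl⟩)
    simp only [evalWord, C, X, map_mul, map_inv,
          Monoid.Coprod.lift_apply_inl, Monoid.Coprod.lift_apply_inr, FreeGroup.lift_apply_of,
          MonoidHom.id_apply] at this
    exact mul_inv_eq_one.1 this

/-! ### Direct complements and the conjugation step -/

/-- `D` commutes with the subgroup generated by `T` and generates with it a direct product. -/
def IsDirectComplement {G : Type u} [Group G] (T D : Set G) : Prop :=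
  (∀ d ∈ D, ∀ a ∈ T, Commute d a) ∧ Disjoint (Subgroup.closure T) (Subgroup.closure D)

theorem commute_of_mem_closure {G : Type u} [Group G] {T D : Set G}
    (h : ∀ d ∈ D, ∀ a ∈ T, Commute d a) {d a : G} (hd : d ∈ Subgroup.closure D)
    (ha : a ∈ Subgroup.closure T) : Commute d a := by
  have h1 : ∀ d ∈ D, d ∈ Subgroup.centralizer (Subgroup.closure T : Set G) := by
    intro d hd
    rw [Subgroup.centralizer_closure]
    exact Subgroup.mem_centralizer_iff.2 fun a ha => ((h d hd a ha).eq).symm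
  exact (Subgroup.mem_centralizer_iff.1 ((Subgroup.closure_le _).2 h1 hd) a ha).symm

theorem IsMitosis.isDirectComplement {G : Type u} [Group G] {T D : Set G} {s u : G}
    (h : IsMitosis T s u) (hD : ∀ d ∈ D, ∀ a ∈ T, Commute d a) (hu : ∀ d ∈ D, Commute u d) :
    IsDirectComplement T D := by
  refine ⟨hD, disjoint_iff_inf_le.2 fun a ha => ?_⟩
  refine Subgroup.mem_bot.2 (h.eq_one_of_commute ha.1 ?_)
  exact (commute_of_mem_closure (T := {u}) (fun d hd x hx => by
    rw [Set.mem_singleton_iff.1 hx]; exact (hu d hd).symm) ha.2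
    (Subgroup.subset_closure rfl)).symm

theorem IsAlephZeroExistentiallyClosed.exists_commute_isDirectComplement {G : Type u} [Group G]
    (hEC : IsAlephZeroExistentiallyClosed G) {T D : Set G} (hT : T.Finite) (hD : D.Finite)
    (h : IsDirectComplement T D) (g : G) :
    ∃ z, (∀ d ∈ D, Commute z d) ∧
      IsDirectComplement T ((fun x => z⁻¹ * x * z) '' insert g D) := by
  obtain ⟨s, u, hsu⟩ := hEC.exists_isMitosis hT
  let A := Subgroup.closure T
  let B := Subgroup.closure D
  have comm : ∀ (a : A) (b : B), Commute (A.subtype a) (B.subtype b) := fun a b =>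
    (commute_of_mem_closure h.1 b.2 a.2).symm
  let m : A × B →* G := A.subtype.noncommCoprod B.subtype comm
  have hm : Injective m := by
    refine (MonoidHom.noncommCoprod_injective _ _ comm).2
      ⟨A.subtype_injective, B.subtype_injective, ?_⟩
    simpa using h.2
  -- Directness of the product of `A` and `B` makes `(a, b) ↦ ab` injective. Then `t` carries `(ab,
  -- 1)` to `(b, a)`: it fixes `B` and moves `A` to the second factor, away from `g`.
  obtain ⟨K, _, i, hi, t, ht⟩ := exists_overgroup_conj (H := G × G)
    ((MonoidHom.inl G G).comp m)
    ((B.subtype.comp (MonoidHom.snd A B)).prod (A.subtype.comp (MonoidHom.fst A B)))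
    (fun a b hab => hm (by simpa using hab))
    (fun a b hab => by
      simp only [MonoidHom.prod_apply, Prod.mk.injEq] at hab
      exact Prod.ext (A.subtype_injective hab.2) (B.subtype_injective hab.1))
  have htT : ∀ a ∈ T, t * i (a, 1) * t⁻¹ = i (1, a) := fun a ha => by
    simpa [m] using ht (⟨a, Subgroup.subset_closure ha⟩, 1)
  have htD : ∀ d ∈ D, Commute t (i (d, 1)) := fun d hd => by
    have := ht (1, ⟨d, Subgroup.subset_closure hd⟩)
    rw [mul_inv_eq_iff_eq_mul] at this
    simpa [m, Commute, SemiconjBy] using this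
  let C : G →* Monoid.Coprod G (FreeGroup (Fin 3)) := Monoid.Coprod.inl
  let X : Fin 3 → Monoid.Coprod G (FreeGroup (Fin 3)) := fun k =>
    Monoid.Coprod.inr (FreeGroup.of k)
  let Y : G → Monoid.Coprod G (FreeGroup (Fin 3)) := fun a => X 0 * C a * (X 0)⁻¹
  -- `X 0` is to be `z`; `X 1` and `X 2` form a mitosis of the conjugate of `T` by `z`, with `X 2`
  -- centralizing `g` and `D`.
  let E : Set (Monoid.Coprod G (FreeGroup (Fin 3))) :=
    (fun d => ⁅X 0, C d⁆) '' D ∪ ((fun a => ⁅C g, Y a⁆) '' T ∪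
    ((fun d => ⁅X 2, C d⁆) '' insert g D ∪
    (Set.image2 (fun a b => ⁅Y a, X 1 * Y b * (X 1)⁻¹⁆) T T ∪
    (fun a => X 2 * Y a * (X 2)⁻¹ * (Y a * (X 1 * Y a * (X 1)⁻¹))⁻¹) '' T)))
  have hE : E.Finite := (hD.image _).union ((hT.image _).union (((hD.insert g).image _).union
    ((hT.image2 _ hT).union (hT.image _))))
  have hY : ∀ {H : Type u} [Group H] (f : G →* H) (v : Fin 3 → H) (a : G),
      Monoid.Coprod.lift f (FreeGroup.lift v) (Y a) = v 0 * f a * (v 0)⁻¹ := by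
    intro H _ f v a
    simp [Y, C, X]
  have hX : ∀ {H : Type u} [Group H] (f : G →* H) (v : Fin 3 → H) (k : Fin 3),
      Monoid.Coprod.lift f (FreeGroup.lift v) (X k) = v k := by
    intro H _ f v a
    simp [X]
  have hC : ∀ {H : Type u} [Group H] (f : G →* H) (v : Fin 3 → H) (a : G),
      Monoid.Coprod.lift f (FreeGroup.lift v) (C a) = f a := by
    intro H _ f v a
    simp [C]
  obtain ⟨v, hv⟩ := hEC.exists_evalWord_eq_one hE (i.comp (MonoidHom.inl G G))
    (hi.comp fun a b h => by simpa using h) ![t, i (1, s), i (1, u)] (by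
      rintro w (⟨d, hd, rfl⟩ | ⟨a, ha, rfl⟩ | ⟨d, hd, rfl⟩ | ⟨a, ha, b, hb, rfl⟩ | ⟨a, ha, rfl⟩)
      · simpa [evalWord, map_commutatorElement, commutatorElement_eq_one_iff_commute, hX, hC]
          using htD d hd
      · simp [evalWord, map_commutatorElement, commutatorElement_eq_one_iff_commute, hY, hC,
          htT a ha, Commute, SemiconjBy, ← map_mul]
      · simp [evalWord, map_commutatorElement, commutatorElement_eq_one_iff_commute, hX, hC,
          Commute, SemiconjBy, ← map_mul]
      · have := (hsu.1 a ha b hb).eq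
        simp only [evalWord, map_commutatorElement, map_mul, map_inv, hX, hY,
          commutatorElement_eq_one_iff_commute]
        simp [htT a ha, htT b hb, Commute, SemiconjBy, ← map_mul, ← map_inv, this]
      · have := hsu.2 a ha
        simp only [evalWord, map_mul, map_inv, hX, hY]
        rw [mul_inv_eq_one]
        simp [htT a ha, ← map_mul, ← map_inv, this])
  have h1 : ∀ d ∈ D, Commute (v 0) d := fun d hd => by
    simpa [evalWord, map_commutatorElement, commutatorElement_eq_one_iff_commute, hX, hC]
      using hv _ (Or.inl ⟨d, hd, rfl⟩)
  have h2 : ∀ a ∈ T, Commute g (v 0 * a * (v 0)⁻¹) := fun a ha => by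
    simpa [evalWord, map_commutatorElement, commutatorElement_eq_one_iff_commute, hY, hC]
      using hv _ (Or.inr (Or.inl ⟨a, ha, rfl⟩))
  have h3 : ∀ d ∈ insert g D, Commute (v 2) d := fun d hd => by
    simpa [evalWord, map_commutatorElement, commutatorElement_eq_one_iff_commute, hX, hC]
      using hv _ (Or.inr (Or.inr (Or.inl ⟨d, hd, rfl⟩)))
  have h4 : ∀ a ∈ T, ∀ b ∈ T, Commute (v 0 * a * (v 0)⁻¹)
      (v 1 * (v 0 * b * (v 0)⁻¹) * (v 1)⁻¹) := fun a ha b hb => by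
    simpa [evalWord, map_commutatorElement, commutatorElement_eq_one_iff_commute, hX, hY]
      using hv _ (Or.inr (Or.inr (Or.inr (Or.inl ⟨a, ha, b, hb, rfl⟩))))
  have h5 : ∀ a ∈ T, v 2 * (v 0 * a * (v 0)⁻¹) * (v 2)⁻¹ =
      (v 0 * a * (v 0)⁻¹) * (v 1 * (v 0 * a * (v 0)⁻¹) * (v 1)⁻¹) := fun a ha => by
    have := hv _ (Or.inr (Or.inr (Or.inr (Or.inr ⟨a, ha, rfl⟩))))
    simp only [evalWord, map_mul, map_inv, hX, hY] at this
    exact mul_inv_eq_one.1 this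
  have hconj : ∀ {x y : G}, Commute x y →
      Commute ((v 0)⁻¹ * x * v 0) ((v 0)⁻¹ * y * v 0) := fun {x y} hxy => by
    simpa using hxy.map (MulAut.conj (v 0)⁻¹).toMonoidHom
  -- Conjugating back by `z` turns this into a mitosis of `T` itself.
  refine ⟨v 0, h1, IsMitosis.isDirectComplement (s := (v 0)⁻¹ * v 1 * v 0)
    (u := (v 0)⁻¹ * v 2 * v 0) ⟨fun a ha b hb => ?_, fun a ha => ?_⟩ ?_ ?_⟩
  · simpa [mul_assoc] using hconj (h4 a ha b hb)
  · have := congrArg (fun x => (v 0)⁻¹ * x * v 0) (h5 a ha)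
    simpa [mul_assoc] using this
  · rintro _ ⟨d, hd, rfl⟩ a ha
    obtain rfl | hd := hd
    · simpa [mul_assoc] using hconj (h2 a ha)
    · have e : (v 0)⁻¹ * d * v 0 = d := by rw [mul_assoc, ← (h1 d hd).eq, inv_mul_cancel_left]
      simp only [e]
      exact h.1 d hd a ha
  · rintro _ ⟨d, hd, rfl⟩
    exact hconj (h3 d hd)

/-! ### Limits of conjugations -/

/-- A limit of conjugations, each of which agrees with the previous ones on a finite set, where
the images of these finite sets satisfy `Q`. -/
theorem exists_monoidHom_of_conj_step {G : Type u} [Group G] [Countable G] (Q : Set G → Prop)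
    (h0 : Q ∅)
    (hstep : ∀ D : Set G, D.Finite → Q D → ∀ g, ∃ z, (∀ d ∈ D, Commute z d) ∧
      Q ((fun x => z⁻¹ * x * z) '' insert g D))
    (S : Set G) (hS : ∀ D, Q D → ∀ c ∈ S, Q (insert c D)) :
    ∃ f : G →* G, Injective f ∧ (∀ g, ∃ D, Q D ∧ f g ∈ D) ∧ ∀ c ∈ S, ∃ g, f g = c := by
  let State := {p : G × Set G // p.2.Finite ∧ Q ((fun b => p.1⁻¹ * b * p.1) '' p.2)}
  have next : ∀ (p : State) (g : G), ∃ q : State, p.1.2 ⊆ q.1.2 ∧ g ∈ q.1.2 ∧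
      (∀ b ∈ p.1.2, q.1.1⁻¹ * b * q.1.1 = p.1.1⁻¹ * b * p.1.1) ∧
      (g ∈ S → ∃ b ∈ q.1.2, q.1.1⁻¹ * b * q.1.1 = g) := by
    -- A state is a conjugator with the finite set on which it is now frozen; passing from `x` to `x
    -- * z` changes nothing on `F`, as `z` commutes with its image.
    rintro ⟨⟨x, F⟩, hF, hQ⟩ g
    obtain ⟨z, hz, hQz⟩ := hstep _ (hF.image _) hQ (x⁻¹ * g * x)
    have hQ' : Q ((fun b => (x * z)⁻¹ * b * (x * z)) '' insert g F) := by
      convert hQz using 1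
      rw [← Set.image_insert_eq (f := fun b => x⁻¹ * b * x), Set.image_image]
      congr 1
      ext b
      group
    have hconj : ∀ b ∈ F, (x * z)⁻¹ * b * (x * z) = x⁻¹ * b * x := fun b hb => by
      have e : (x * z)⁻¹ * b * (x * z) = z⁻¹ * ((x⁻¹ * b * x) * z) := by group
      rw [e, ← (hz _ ⟨b, hb, rfl⟩).eq, inv_mul_cancel_left]
    by_cases hg : g ∈ S
    -- The preimage of `g` under the current conjugation joins the frozen set, so `g` stays in the
    -- image.
    · have e : (x * z)⁻¹ * (x * z * g * (x * z)⁻¹) * (x * z) = g := by group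
      refine ⟨⟨(x * z, insert (x * z * g * (x * z)⁻¹) (insert g F)),
        (hF.insert _).insert _, ?_⟩, fun b hb => Or.inr (Or.inr hb), Or.inr (Or.inl rfl),
        hconj, fun _ => ⟨_, Or.inl rfl, e⟩⟩
      simp only [Set.image_insert_eq (f := fun b => (x * z)⁻¹ * b * (x * z)) (a := _ * _), e]
      exact hS _ hQ' g hg
    · exact ⟨⟨(x * z, insert g F), hF.insert _, hQ'⟩, fun b hb => Or.inr hb, Or.inl rfl,
        hconj, fun h => absurd h hg⟩
  choose nx hsub hmem hagree hsurj using next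
  obtain ⟨e, he⟩ := exists_surjective_nat G
  let p : ℕ → State := fun k =>
    Nat.rec ⟨(1, ∅), Set.finite_empty, by simpa using h0⟩ (fun k q => nx q (e k)) k
  have hp : ∀ k, p (k + 1) = nx (p k) (e k) := fun k => rfl
  have mono : Monotone fun k => (p k).1.2 := monotone_nat_of_le_succ fun k => hsub _ _
  let c : ℕ → G → G := fun k b => (p k).1.1⁻¹ * b * (p k).1.1
  have stable : ∀ {k l b}, k ≤ l → b ∈ (p k).1.2 → c l b = c k b := by
    intro k l b hkl hb
    induction l, hkl using Nat.le_induction with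
    | base => rfl
    | succ l hl ih => rw [← ih]; exact hagree (p l) (e l) b (mono hl hb)
  have cover : ∀ g, ∃ k, g ∈ (p k).1.2 := fun g => by
    obtain ⟨k, rfl⟩ := he g
    exact ⟨k + 1, hmem (p k) (e k)⟩
  choose N hN using cover
  have hc : ∀ {g k}, g ∈ (p k).1.2 → c (N g) g = c k g := by
    intro g k hk
    rw [← stable (le_max_left (N g) k) (hN g), stable (le_max_right (N g) k) hk]
  have hc' : ∀ {g k}, N g ≤ k → c (N g) g = c k g := fun {g k} hk => hc (mono hk (hN g))
  refine ⟨MonoidHom.mk' (fun g => c (N g) g) fun a b => ?_, fun a b hab => ?_, fun g => ?_,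
    fun g hg => ?_⟩
  -- At a stage beyond all three indices the limit agrees with a single conjugation.
  · have l1 : N a ≤ N a + N b + N (a * b) := by omega
    have l2 : N b ≤ N a + N b + N (a * b) := by omega
    have l3 : N (a * b) ≤ N a + N b + N (a * b) := by omega
    rw [hc' l1, hc' l2, hc' l3]
    simp only [c]
    group
  · replace hab : c (N a) a = c (N b) b := hab
    rw [hc' (Nat.le_add_right (N a) (N b)), hc' (Nat.le_add_left (N b) (N a))] at hab
    simpa [c] using hab
  · exact ⟨_, (p (N g)).2.2, g, hN g, rfl⟩
  · obtain ⟨k, rfl⟩ := he g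
    obtain ⟨b, hb, hbk⟩ := hsurj (p k) (e k) hg
    exact ⟨b, (hc (k := k + 1) hb).trans hbk⟩

/-! ### The centralizer -/

/-- An element common to the two closures commutes with all of the closure of `T`, so it is central
there. -/
theorem isDirectComplement_of_center_eq_bot {G : Type u} [Group G] {T D : Set G}
    (hZ : Subgroup.center (Subgroup.closure T) = ⊥) (hD : ∀ d ∈ D, ∀ a ∈ T, Commute d a) :
    IsDirectComplement T D := by
  refine ⟨hD, disjoint_iff_inf_le.2 fun a ha => ?_⟩
  have hz : (⟨a, ha.1⟩ : Subgroup.closure T) ∈ Subgroup.center (Subgroup.closure T) :=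
    Subgroup.mem_center_iff.2 fun b =>
      Subtype.ext (commute_of_mem_closure hD ha.2 b.2).eq.symm
  rw [hZ, Subgroup.mem_bot] at hz
  exact Subgroup.mem_bot.2 (congrArg Subtype.val hz)

theorem IsAlephZeroExistentiallyClosed.exists_monoidHom_centralizer {G : Type u} [Group G]
    [Countable G] (hEC : IsAlephZeroExistentiallyClosed G) {A : Subgroup G} (hA : A.FG) :
    ∃ f : G →* Subgroup.centralizer (A : Set G), Injective f ∧
      (Subgroup.center A = ⊥ → Surjective f) := by
  obtain ⟨T, rfl, hT⟩ := (Subgroup.fg_iff A).1 hA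
  have h0 : IsDirectComplement T ∅ := ⟨by simp, by simp⟩
  have hcent : ∀ x, x ∈ Subgroup.centralizer (Subgroup.closure T : Set G) ↔
      ∀ a ∈ T, Commute x a := fun x => by
    rw [Subgroup.centralizer_closure, Subgroup.mem_centralizer_iff]
    exact forall₂_congr fun a _ => eq_comm
  obtain ⟨f, hf, hfQ, hfS⟩ := exists_monoidHom_of_conj_step (IsDirectComplement T) h0
    (fun D hD h g => hEC.exists_commute_isDirectComplement hT hD h g)
    -- The target set is empty unless the center is trivial, so one construction serves both claims.
    {c | Subgroup.center (Subgroup.closure T) = ⊥ ∧ ∀ a ∈ T, Commute c a}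
    (fun D hD c hc => isDirectComplement_of_center_eq_bot hc.1 (by
      rintro d (rfl | hd)
      exacts [hc.2, hD.1 d hd]))
  have hmem : ∀ g, f g ∈ Subgroup.centralizer (Subgroup.closure T : Set G) := fun g => by
    obtain ⟨D, hD, hg⟩ := hfQ g
    exact (hcent _).2 (hD.1 _ hg)
  refine ⟨f.codRestrict _ hmem, fun a b hab => hf (congrArg Subtype.val hab), fun hZ c => ?_⟩
  obtain ⟨g, hg⟩ := hfS c ⟨hZ, (hcent _).1 c.2⟩
  exact ⟨g, Subtype.ext hg⟩

theorem proposition3p3 {G : Type u} [Group G] [Countable G]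
    (hEC : IsAlephZeroExistentiallyClosed G) (hG : ¬ IsSofic G)
    (A : Subgroup G) (hA : A.FG) :
    ¬ IsSofic (Subgroup.centralizer (A : Set G)) ∧
      (Subgroup.center A = ⊥ →
        Nonempty (Subgroup.centralizer (A : Set G) ≃* G) ∧
        Countable (Subgroup.centralizer (A : Set G)) ∧
        IsAlephZeroExistentiallyClosed (Subgroup.centralizer (A : Set G)) ∧
        ¬ IsSofic (Subgroup.centralizer (A : Set G))) := by
  obtain ⟨f, hf, hsurj⟩ := hEC.exists_monoidHom_centralizer hA
  have hns : ¬ IsSofic (Subgroup.centralizer (A : Set G)) := fun h => hG (h.of_injective f hf)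
  refine ⟨hns, fun hZ => ?_⟩
  let e : G ≃* Subgroup.centralizer (A : Set G) := MulEquiv.ofBijective f ⟨hf, hsurj hZ⟩
  exact ⟨⟨e.symm⟩, inferInstance, hEC.of_mulEquiv e, hns⟩
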